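/- Setting. Let $A\in\mathbb R^{n\times n}$ be the symmetric adjacency matrix of an undirected network on $n$ nodes without self-loops and with at least one edge (0/1 entries, or more generally nonnegative edge weights). Let $D$ be the diagonal matrix of degrees $d_i=\sum_j A_{ij}$, let $\bar d=\frac1n\sum_i d_i$, and let $\mathcal L_s=\bar d^{-1}(D-A)$ be the standardized Laplacian. Write $\mathcal L_s=U\Lambda U^T$ with $U$ orthogonal and $\Lambda=\mathrm{diag}(\tau_1,\dots,\tau_n)$, $\tau_1\ge\dots\ge\tau_n=0$. The effective dimension of the network is $$m_A=\min\{m:\ 1\le m\le n-1,\ \tau_{n-m}\ge 1/\sqrt m\}.$$ A vector $v=U\beta\in\mathbb R^n$ is cohesive on $A$ with rate $\delta$ if $\tau_i|\beta_i|\le n^{-\frac{1+\delta}3-\frac12}\|\beta\|_2$ for all $i<n$. Model. $X\in\mathbb R^{n\times p}$ has independent Gaussian rows $X_{i\cdot}\sim\mathcal N(M_{i\cdot},\Sigma)$, with $\Sigma$ positive definite and $\max_j\Sigma_{jj}\le\sigma^2$. Every column of the mean matrix $M\in\mathbb R^{n\times p}$ is cohesive on $A$ with rate $\delta\ge0$ (with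 respect to the same $U$) and satisfies $\|M_{\cdot j}\|_2^2\le b^2n$. Estimators. With $\alpha=n^{\frac{1+\delta}3}$ let $$\hat M=\arg\min_{M'\in\mathbb R^{n\times p}}\ \|X-M'\|_F^2+\alpha\,\mathrm{tr}(M'^T\mathcal L_sM'),\qquad \hat S=\tfrac1n(X-\hat M)^T(X-\hat M),$$ and write $\|B\|_\infty=\max_{j,k}|B_{jk}|$. Lemma. For all $b,\sigma>0$ there are constants $C,c>0$, depending only on $b$ and $\sigma$, with the following property. Let $\delta\ge0$, and let $p=p_n\ge1$ and networks $A=A_n$ on $n$ nodes ($n\to\infty$) satisfy $\log p=o(n)$ and $m_A=o(n)$. Then for all sufficiently large $n$, and for all $M$, $\Sigma$, $X$ as above, $$\|\hat S-\Sigma\|_\infty\le C\max\Big(\sqrt{\log(pn)}\,m_A n^{-\frac{2+2\delta}3},\ \sqrt{\log(pn)}\sqrt{\log p}\,m_A^{3/2}n^{-\frac{4+\delta}3},\ \sqrt{\log(pn)}\sqrt{m_A}\,n^{-\frac{1+\delta}3},\ \sqrt{\log(pn)}\sqrt{\log p}\,\frac{m_A}n,\ \sqrt{\frac{\log p}n}\Big)$$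 with probability at least $1-\exp(-c\log(p(n-m_A)))-\exp(-c\log(pm_A))-\exp(-c\log p)$. -/

import Mathlib

open MeasureTheory ProbabilityTheory Filter Asymptotics

noncomputable section

namespace GNC

/-- An undirected network on `n` nodes without self-loops, given by its adjacency matrix. An
unweighted network has entries in `{0, 1}`; arbitrary nonnegative edge weights are allowed. -/
structure Network (n : ℕ) where
  adj : Matrix (Fin n) (Fin n) ℝ
  symm : adj.IsSymm
  nonneg : ∀ i j, 0 ≤ adj i j
  diag_zero : ∀ i, adj i i = 0

namespace Network

variable {n : ℕ}

/-- The degree of a node. -/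
def degree (A : Network n) (i : Fin n) : ℝ := ∑ j, A.adj i j

/-- The average degree. -/
def avgDegree (A : Network n) : ℝ := (∑ i, A.degree i) / n

/-- The standardized Laplacian `L_s = (D - A) / d̄`. -/
def stdLaplacian (A : Network n) : Matrix (Fin n) (Fin n) ℝ :=
  (A.avgDegree)⁻¹ • (Matrix.diagonal A.degree - A.adj)

theorem isHermitian_stdLaplacian (A : Network n) : A.stdLaplacian.IsHermitian := by
  have h : A.adj.transpose = A.adj := A.symm
  simp [Matrix.IsHermitian, stdLaplacian, Matrix.conjTranspose_eq_transpose_of_trivial,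
    Matrix.transpose_smul, Matrix.transpose_sub, h]

/-- The eigenvalues of the standardized Laplacian with multiplicity, in decreasing order:
`A.eig i` is the mathematical `τ_{i+1}`, so `τ_1 ≥ ⋯ ≥ τ_n`. -/
def eig (A : Network n) (i : Fin n) : ℝ :=
  A.isHermitian_stdLaplacian.eigenvalues₀ (Fin.cast (Fintype.card_fin n).symm i)

/-- The effective dimension `m_A`: the least `m` with `1 ≤ m ≤ n - 1` and `τ_{n-m} ≥ 1 / √m`.
(The index `i` below is `n - m` shifted to start from `0`.) -/
def effDim (A : Network n) : ℕ :=
  sInf {m : ℕ | 1 ≤ m ∧ ∃ i : Fin n, (i : ℕ) + 1 + m = n ∧ 1 / √(m : ℝ) ≤ A.eig i}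

/-- `U` diagonalizes the standardized Laplacian: it is orthogonal, and its `i`-th column is an
eigenvector for the `i`-th largest eigenvalue. -/
def IsEigenbasis (A : Network n) (U : Matrix (Fin n) (Fin n) ℝ) : Prop :=
  U ∈ Matrix.orthogonalGroup (Fin n) ℝ ∧
    A.stdLaplacian = U * Matrix.diagonal A.eig * U.transpose

/-- The vector `v = U β` is cohesive on the network with rate `δ` (with respect to the eigenbasis
`U`): `τ_i |β_i| ≤ n^{-(1+δ)/3 - 1/2} ‖β‖₂` for all `i < n`. -/
def IsCohesive (A : Network n) (U : Matrix (Fin n) (Fin n) ℝ) (δ : ℝ) (v : Fin n → ℝ) : Prop :=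
  ∀ i : Fin n, (i : ℕ) + 1 < n →
    A.eig i * |(U.transpose.mulVec v) i| ≤
      (n : ℝ) ^ (-(1 + δ) / 3 - 1 / 2) * ‖WithLp.toLp 2 (U.transpose.mulVec v)‖

/-- The objective `‖X - M‖_F² + α tr(Mᵀ L_s M)` of the mean estimation step. -/
def meanObjective (A : Network n) {p : ℕ} (α : ℝ) (X M : Matrix (Fin n) (Fin p) ℝ) : ℝ :=
  ((X - M).transpose * (X - M)).trace + α * (M.transpose * A.stdLaplacian * M).trace

/-- `Mhat` is the mean estimate `argmin_M ‖X - M‖_F² + α tr(Mᵀ L_s M)`. -/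
def IsMeanEstimate (A : Network n) {p : ℕ} (α : ℝ) (X Mhat : Matrix (Fin n) (Fin p) ℝ) : Prop :=
  IsMinOn (A.meanObjective α X) Set.univ Mhat

end Network

/-- The assumption on the mean matrix: all its columns are cohesive on the network with rate `δ`,
and have squared Euclidean norm at most `b² n`. -/
def MeanAssumption {n p : ℕ} (A : Network n) (U : Matrix (Fin n) (Fin n) ℝ) (δ b : ℝ)
    (M : Matrix (Fin n) (Fin p) ℝ) : Prop :=
  ∀ j : Fin p, A.IsCohesive U δ (fun i => M i j) ∧
    ‖WithLp.toLp 2 (fun i => M i j)‖ ^ 2 ≤ b ^ 2 * n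

/-- The Gaussian model: the rows of the random matrix `X` are independent, and the `i`-th row has
law `N(M_{i·}, S)`. -/
def GaussianModel {n p : ℕ} {Ω : Type*} [MeasurableSpace Ω] (P : Measure Ω)
    (X : Ω → Matrix (Fin n) (Fin p) ℝ) (M : Matrix (Fin n) (Fin p) ℝ)
    (S : Matrix (Fin p) (Fin p) ℝ) : Prop :=
  iIndepFun (fun (i : Fin n) (ω : Ω) => WithLp.toLp 2 (X ω i)) P ∧
    ∀ i : Fin n, HasLaw (fun ω => WithLp.toLp 2 (X ω i))
      (multivariateGaussian (WithLp.toLp 2 (M i)) S) P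

/-- The sample covariance `(1/n) (X - M)ᵀ (X - M)`. -/
def sampleCov {n p : ℕ} (X M : Matrix (Fin n) (Fin p) ℝ) : Matrix (Fin p) (Fin p) ℝ :=
  (1 / (n : ℝ)) • ((X - M).transpose * (X - M))

/-- The entrywise maximum norm `max_{j,k} |B_{jk}|`. -/
def maxNorm {p q : ℕ} (B : Matrix (Fin p) (Fin q) ℝ) : ℝ :=
  ⨆ jk : Fin p × Fin q, |B jk.1 jk.2|

/-- The maximum of the five rates, with `n` observations, `p` variables, effective dimension `m`
and cohesion rate `δ`. -/
def covRate (n p m : ℕ) (δ : ℝ) : ℝ :=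
  max (√(Real.log (p * n)) * m * (n : ℝ) ^ (-(2 + 2 * δ) / 3))
    (max (√(Real.log (p * n)) * √(Real.log p) * (m : ℝ) ^ (3 / 2 : ℝ) *
        (n : ℝ) ^ (-(4 + δ) / 3))
      (max (√(Real.log (p * n)) * √(m : ℝ) * (n : ℝ) ^ (-(1 + δ) / 3))
        (max (√(Real.log (p * n)) * √(Real.log p) * (m / n))
          (√(Real.log p / n)))))

end GNC

end

/-! Put `α = n^((1+δ)/3)`. The mean step is ridge regression, so in the eigenbasis the residual `X -
Mhat` is `Uᵀ X` with row `i` multiplied by `h_i = α τ_i / (1 + α τ_i)`. For a fixed direction `a`,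
the rotated data `Uᵀ X a` is `β + g`, where `β = Uᵀ M a` and `g` has independent `N(0, q)` entries,
`q = aᵀ S a`. Hence `n (aᵀ Ŝ a - q)` is a bias `∑ h_i² β_i²`, plus a centred Gaussian quadratic `T`,
minus the shrinkage loss `q ∑ (1 - h_i²)`.

Cohesion makes `h_i |β_i|` at most a multiple of `(1 + α τ_i)⁻¹`, and the loss is at most `2q ∑ (1 +
α τ_i)⁻¹`. Splitting these sums at the effective dimension `m` (`IsEigenbasis.sum_le`) bounds the
bias by order `m + n m / α²` and the loss by order `m + n √m / α`. A Chernoff bound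
(`gaussian_quadratic_tail`) gives `T` order `√(n log p)`, up to the bias bound. After division by
`n`, four of the five rates absorb everything.

Polarization along `e_j ± e_k` and a union bound over all pairs pass from directions to entries. -/

namespace GNC

/-! ### Exponential moments and tails of Gaussian quadratics -/

/-- For `x < 1/2`, the tilted standard Gaussian density is a multiple of a Gaussian density. -/
theorem gaussianPDFReal_mul_exp_quadratic {x : ℝ} (hx : x < 1 / 2) (y z : ℝ) :
    gaussianPDFReal 0 1 z * Real.exp (x * (z ^ 2 - 1) + y * z) =
      √((1 - 2 * x)⁻¹) * Real.exp (y ^ 2 / (2 * (1 - 2 * x)) - x) *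
        gaussianPDFReal (y / (1 - 2 * x)) (1 - 2 * x)⁻¹.toNNReal z := by
  have h : 0 < 1 - 2 * x := by linarith
  have hw : ((1 - 2 * x)⁻¹.toNNReal : ℝ) = (1 - 2 * x)⁻¹ := Real.coe_toNNReal _ (by positivity)
  have h0 : √((1 - 2 * x)⁻¹) ≠ 0 := (Real.sqrt_pos.2 (by positivity)).ne'
  simp only [gaussianPDFReal, hw, NNReal.coe_one, mul_one]
  rw [Real.sqrt_mul (by positivity) (1 - 2 * x)⁻¹, mul_inv]
  have : √((1 - 2 * x)⁻¹) * Real.exp (y ^ 2 / (2 * (1 - 2 * x)) - x) *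
      ((√(2 * Real.pi))⁻¹ * (√((1 - 2 * x)⁻¹))⁻¹ *
        Real.exp (-(z - y / (1 - 2 * x)) ^ 2 / (2 * (1 - 2 * x)⁻¹))) =
      (√(2 * Real.pi))⁻¹ * (Real.exp (y ^ 2 / (2 * (1 - 2 * x)) - x) *
        Real.exp (-(z - y / (1 - 2 * x)) ^ 2 / (2 * (1 - 2 * x)⁻¹))) := by
    field_simp
  rw [this, mul_assoc, ← Real.exp_add, ← Real.exp_add]
  congr 2
  field_simp
  ring

theorem integral_exp_quadratic_gaussianReal {x : ℝ} (hx : x < 1 / 2) (y : ℝ) :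
    ∫ z, Real.exp (x * (z ^ 2 - 1) + y * z) ∂(gaussianReal 0 1) =
      √((1 - 2 * x)⁻¹) * Real.exp (y ^ 2 / (2 * (1 - 2 * x)) - x) := by
  have h : 0 < 1 - 2 * x := by linarith
  rw [integral_gaussianReal_eq_integral_smul one_ne_zero]
  simp only [smul_eq_mul, gaussianPDFReal_mul_exp_quadratic hx]
  rw [integral_const_mul, integral_gaussianPDFReal_eq_one, mul_one]
  simpa using h

theorem integrable_exp_quadratic_gaussianReal {x : ℝ} (hx : x < 1 / 2) (y : ℝ) :
    Integrable (fun z => Real.exp (x * (z ^ 2 - 1) + y * z)) (gaussianReal 0 1) := by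
  have h : 0 < 1 - 2 * x := by linarith
  have h0 : 0 < √((1 - 2 * x)⁻¹) := Real.sqrt_pos.2 (by positivity)
  -- The Bochner integral of a non-integrable function is `0`, so the nonzero value just computed
  -- already gives integrability.
  apply Integrable.of_integral_ne_zero
  rw [integral_exp_quadratic_gaussianReal hx]
  positivity

theorem integral_exp_quadratic_gaussianReal_le {x : ℝ} (hx : |x| ≤ 1 / 4) (y : ℝ) :
    ∫ z, Real.exp (x * (z ^ 2 - 1) + y * z) ∂(gaussianReal 0 1) ≤
      Real.exp (2 * x ^ 2 + y ^ 2) := by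
  obtain ⟨h1, h2⟩ := abs_le.1 hx
  have h : 0 < 1 - 2 * x := by linarith
  rw [integral_exp_quadratic_gaussianReal (by linarith)]
  have hs : √((1 - 2 * x)⁻¹) ≤ Real.exp (x + 2 * x ^ 2) := by
    rw [Real.sqrt_le_left (Real.exp_pos _).le, ← Real.exp_nat_mul, inv_le_comm₀ h (Real.exp_pos _),
      ← Real.exp_neg]
    -- The claim is `(1 - 2x) exp(2x + 4x²) ≥ 1`. For `x < 0` the bound `exp u ≥ 1 + u` suffices,
    -- giving `1 - 8x³`; for `x ≥ 0` the term `u²/2` is needed too.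
    by_cases h0 : 0 ≤ x
    · have := Real.quadratic_le_exp_of_nonneg (x := (2 : ℕ) * (x + 2 * x ^ 2)) (by positivity)
      rw [Real.exp_neg, inv_le_comm₀ (Real.exp_pos _) h]
      refine le_trans ?_ this
      rw [inv_le_iff_one_le_mul₀ h]
      push_cast
      nlinarith [mul_nonneg (sq_nonneg x) h0, mul_nonneg (sq_nonneg x) (sub_nonneg.2 h2),
        mul_nonneg (mul_nonneg (sq_nonneg x) h0) (sub_nonneg.2 h2),
        mul_nonneg (mul_nonneg (sq_nonneg x) (sq_nonneg x)) (sub_nonneg.2 h2)]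
    · push Not at h0
      have := Real.add_one_le_exp ((2 : ℕ) * (x + 2 * x ^ 2))
      have hp : 0 < (2 : ℕ) * (x + 2 * x ^ 2) + 1 := by push_cast; nlinarith
      rw [Real.exp_neg, inv_le_comm₀ (Real.exp_pos _) h]
      refine le_trans ?_ this
      rw [inv_le_iff_one_le_mul₀ h]
      push_cast
      nlinarith [mul_nonneg (sq_nonneg x) (neg_nonneg.2 h0.le)]
  calc _ ≤ Real.exp (x + 2 * x ^ 2) * Real.exp (y ^ 2 - x) := by
        gcongr
        rw [div_le_iff₀ (by linarith)]
        nlinarith [sq_nonneg y]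
    _ = _ := by rw [← Real.exp_add]; ring_nf

/-- Chernoff bound for a quadratic function of independent standard Gaussian variables. -/
theorem gaussian_quadratic_chernoff {n : ℕ} (x y : Fin n → ℝ) (hx : ∀ i, |x i| ≤ 1 / 4) (ε : ℝ) :
    (Measure.pi fun _ : Fin n => gaussianReal 0 1).real
        {z | ε ≤ ∑ i, (x i * (z i ^ 2 - 1) + y i * z i)} ≤
      Real.exp (-ε + ∑ i, (2 * x i ^ 2 + y i ^ 2)) := by
  have hlt : ∀ i, x i < 1 / 2 := fun i => by linarith [(abs_le.1 (hx i)).2]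
  have hexp : ∀ z : Fin n → ℝ, Real.exp (1 * ∑ i, (x i * (z i ^ 2 - 1) + y i * z i)) =
      ∏ i, Real.exp (x i * (z i ^ 2 - 1) + y i * z i) := fun z => by rw [one_mul, Real.exp_sum]
  have hint : Integrable
      (fun z : Fin n → ℝ => Real.exp (1 * ∑ i, (x i * (z i ^ 2 - 1) + y i * z i)))
      (Measure.pi fun _ : Fin n => gaussianReal 0 1) := by
    simp only [hexp]
    exact Integrable.fintype_prod
      (f := fun i t => Real.exp (x i * (t ^ 2 - 1) + y i * t))
      fun i => integrable_exp_quadratic_gaussianReal (hlt i) (y i)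
  refine (measure_ge_le_exp_mul_mgf ε zero_le_one hint).trans ?_
  rw [Real.exp_add, neg_one_mul]
  gcongr
  simp only [mgf, hexp]
  rw [integral_fintype_prod_eq_prod (fun i t => Real.exp (x i * (t ^ 2 - 1) + y i * t)),
    Real.exp_sum]
  exact Finset.prod_le_prod (fun i _ => integral_nonneg fun _ => (Real.exp_pos _).le)
    fun i _ => integral_exp_quadratic_gaussianReal_le (hx i) (y i)

/-- Chernoff with parameter `± r / (4v)`, `r = √(L/n)`; since `r ≤ 1`, the square coefficients stay
below `1/4`. The exponent gains `21L/4` from the threshold and loses `L/8` to the squares, leaving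
more than `5L`. The variance of the linear part costs at most `r B / (4v)`, which is exactly what
the extra `B` in the threshold pays for. -/
theorem gaussian_quadratic_tail {n : ℕ} (w β : Fin n → ℝ) (hw0 : ∀ i, 0 ≤ w i)
    (hw1 : ∀ i, w i ≤ 1) {s v B L : ℝ} (hv : 0 < v) (hs : s ^ 2 ≤ v)
    (hB : ∑ i, w i * β i ^ 2 ≤ B) (hL : 0 < L) (hLn : L ≤ n) :
    (Measure.pi fun _ : Fin n => gaussianReal 0 1).real
        {z | 21 * v * √(n * L) + B ≤
          |∑ i, (w i * s ^ 2 * (z i ^ 2 - 1) + 2 * w i * β i * s * z i)|} ≤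
      2 * Real.exp (-5 * L) := by
  have hn : (0 : ℝ) < n := hL.trans_le hLn
  have hB0 : 0 ≤ B := (Finset.sum_nonneg fun i _ => mul_nonneg (hw0 i) (sq_nonneg _)).trans hB
  set r := √(L / n) with hr
  have hr2 : r ^ 2 = L / n := Real.sq_sqrt (by positivity)
  have hr0 : 0 < r := Real.sqrt_pos.2 (by positivity)
  have hr1 : r ≤ 1 := Real.sqrt_le_one.2 ((div_le_one hn).2 hLn)
  have hrn : √(n * L) = n * r := by
    rw [Real.sqrt_eq_iff_eq_sq (by positivity) (by positivity), mul_pow, hr2]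
    field_simp
  have key : ∀ t : ℝ, |t| = r / (4 * v) →
      (Measure.pi fun _ : Fin n => gaussianReal 0 1).real
        {z | r / (4 * v) * (21 * v * √(n * L) + B) ≤
          t * ∑ i, (w i * s ^ 2 * (z i ^ 2 - 1) + 2 * w i * β i * s * z i)} ≤
        Real.exp (-5 * L) := by
    intro t ht
    have ht2 : t ^ 2 = r ^ 2 / (16 * v ^ 2) := by rw [← sq_abs, ht]; field_simp; norm_num
    have := gaussian_quadratic_chernoff (fun i => t * (w i * s ^ 2))
      (fun i => t * (2 * w i * β i * s)) (fun i => by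
        rw [abs_mul, ht, abs_of_nonneg (mul_nonneg (hw0 i) (sq_nonneg s))]
        have h1 : w i * s ^ 2 ≤ v := by nlinarith [hw0 i, hw1 i, sq_nonneg s]
        calc r / (4 * v) * (w i * s ^ 2) ≤ 1 / (4 * v) * v := by
              have := hw0 i
              gcongr
          _ = 1 / 4 := by field_simp) (r / (4 * v) * (21 * v * √(n * L) + B))
    refine le_trans (le_of_eq ?_) (this.trans (Real.exp_le_exp.2 ?_))
    · congr 1
      ext z
      simp only [Set.mem_ofPred_eq, Finset.mul_sum]
      rw [Finset.sum_congr rfl fun i _ => by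
        rw [show t * (w i * s ^ 2 * (z i ^ 2 - 1) + 2 * w i * β i * s * z i) =
          t * (w i * s ^ 2) * (z i ^ 2 - 1) + t * (2 * w i * β i * s) * z i by ring]]
    · have hsum : ∑ i, (2 * (t * (w i * s ^ 2)) ^ 2 + (t * (2 * w i * β i * s)) ^ 2) ≤
          2 * t ^ 2 * v ^ 2 * n + 4 * t ^ 2 * v * B := by
        calc _ ≤ ∑ i, (2 * t ^ 2 * v ^ 2 + 4 * t ^ 2 * v * (w i * β i ^ 2)) := by
              refine Finset.sum_le_sum fun i _ => ?_
              have h0 := hw0 i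
              have hw2 : w i ^ 2 ≤ w i := by nlinarith [hw1 i]
              have hw3 : w i ^ 2 ≤ 1 := hw2.trans (hw1 i)
              have h4 : (s ^ 2) ^ 2 ≤ v ^ 2 := by gcongr
              have e1 : w i ^ 2 * (s ^ 2) ^ 2 ≤ 1 * v ^ 2 := by gcongr
              have e2 : w i ^ 2 * s ^ 2 ≤ w i * v := by gcongr
              have e3 := mul_le_mul_of_nonneg_left e1 (sq_nonneg t)
              have e4 := mul_le_mul_of_nonneg_left e2 (sq_nonneg (t * β i))
              nlinarith
          _ = 2 * t ^ 2 * v ^ 2 * n + 4 * t ^ 2 * v * ∑ i, w i * β i ^ 2 := by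
              rw [Finset.sum_add_distrib, Finset.sum_const, Finset.card_univ, Fintype.card_fin,
                nsmul_eq_mul, ← Finset.mul_sum]
              ring
          _ ≤ _ := by gcongr
      have e1 : 2 * t ^ 2 * v ^ 2 * n = L / 8 := by rw [ht2, hr2]; field_simp; norm_num
      have e2 : 4 * t ^ 2 * v * B ≤ r / (4 * v) * B := by
        have : 4 * t ^ 2 * v = r / (4 * v) * r := by rw [ht2]; field_simp; norm_num
        rw [this]
        have : r / (4 * v) * r ≤ r / (4 * v) * 1 := by gcongr
        gcongr
        linarith
      have e3 : r / (4 * v) * (21 * v * √(n * L) + B) = 21 / 4 * L + r / (4 * v) * B := by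
        have : r / (4 * v) * (21 * v * (n * r)) = 21 / 4 * (n * r ^ 2) := by field_simp
        rw [hrn, mul_add, this, hr2]
        field_simp
      linarith
  have h0 : 0 < r / (4 * v) := by positivity
  calc _ ≤ (Measure.pi fun _ : Fin n => gaussianReal 0 1).real
        ({z | r / (4 * v) * (21 * v * √(n * L) + B) ≤
          (r / (4 * v)) * ∑ i, (w i * s ^ 2 * (z i ^ 2 - 1) + 2 * w i * β i * s * z i)} ∪
        {z | r / (4 * v) * (21 * v * √(n * L) + B) ≤
          (-(r / (4 * v))) * ∑ i, (w i * s ^ 2 * (z i ^ 2 - 1) + 2 * w i * β i * s * z i)}) := by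
        refine measureReal_mono fun z hz => ?_
        rcases le_abs.1 (Set.mem_ofPred_eq ▸ hz) with h | h
        · exact Or.inl (mul_le_mul_of_nonneg_left h h0.le)
        · refine Or.inr ?_
          rw [Set.mem_ofPred_eq, neg_mul, ← mul_neg]
          exact mul_le_mul_of_nonneg_left h h0.le
    _ ≤ _ := (measureReal_union_le _ _).trans (by
        linarith [key _ (abs_of_pos h0), key (-(r / (4 * v))) (by rw [abs_neg, abs_of_pos h0])])

/-! ### The Gaussian model in rotated coordinates -/

open scoped Matrix

/-- A linear functional of a multivariate Gaussian vector is a real Gaussian variable. -/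
theorem hasLaw_inner_multivariateGaussian {p : ℕ} {S : Matrix (Fin p) (Fin p) ℝ}
    (hS : S.PosSemidef) (μ : EuclideanSpace ℝ (Fin p)) (a : Fin p → ℝ) :
    HasLaw (fun x : EuclideanSpace ℝ (Fin p) => x.ofLp ⬝ᵥ a)
      (gaussianReal (μ.ofLp ⬝ᵥ a) (a ⬝ᵥ S *ᵥ a).toNNReal) (multivariateGaussian μ S) := by
  have hL : (fun x : EuclideanSpace ℝ (Fin p) => x.ofLp ⬝ᵥ a) =
      innerSL ℝ (WithLp.toLp 2 a) := by
    ext x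
    simp [EuclideanSpace.inner_eq_star_dotProduct]
  refine ⟨by fun_prop, ?_⟩
  rw [hL, IsGaussian.map_eq_gaussianReal]
  congr 1
  · rw [(innerSL ℝ (WithLp.toLp 2 a)).integral_comp_id_comm IsGaussian.integrable_id,
      integral_id_multivariateGaussian, ← hL]
  · have := covarianceBilin_self (μ := multivariateGaussian μ S) IsGaussian.memLp_two_id
      (WithLp.toLp 2 a)
    rw [covarianceBilin_multivariateGaussian hS] at this
    rw [this]
    congr 2

theorem dotProduct_transpose_mulVec {n : ℕ} {U : Matrix (Fin n) (Fin n) ℝ}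
    (hU : U ∈ Matrix.orthogonalGroup (Fin n) ℝ) (x y : Fin n → ℝ) :
    (Uᵀ *ᵥ x) ⬝ᵥ (Uᵀ *ᵥ y) = x ⬝ᵥ y := by
  rw [Matrix.dotProduct_mulVec, Matrix.vecMul_transpose, Matrix.mulVec_mulVec,
    (Matrix.mem_orthogonalGroup_iff _ _).1 hU, Matrix.one_mulVec]

theorem norm_transpose_mulVec {n : ℕ} {U : Matrix (Fin n) (Fin n) ℝ}
    (hU : U ∈ Matrix.orthogonalGroup (Fin n) ℝ) (x : Fin n → ℝ) :
    ‖WithLp.toLp 2 (Uᵀ *ᵥ x)‖ = ‖WithLp.toLp 2 x‖ := by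
  rw [← sq_eq_sq₀ (norm_nonneg _) (norm_nonneg _), EuclideanSpace.real_norm_sq_eq,
    EuclideanSpace.real_norm_sq_eq]
  simpa only [dotProduct, sq] using dotProduct_transpose_mulVec hU x x

/-- The standard Gaussian product measure is invariant under orthogonal matrices. -/
theorem map_mulVec_pi_gaussianReal {n : ℕ} {U : Matrix (Fin n) (Fin n) ℝ}
    (hU : U ∈ Matrix.orthogonalGroup (Fin n) ℝ) :
    (Measure.pi fun _ : Fin n => gaussianReal 0 1).map (fun z => Uᵀ *ᵥ z) =
      Measure.pi fun _ : Fin n => gaussianReal 0 1 := by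
  have h1 := (Matrix.mem_orthogonalGroup_iff _ _).1 hU
  have h2 := (Matrix.mem_orthogonalGroup_iff' _ _).1 hU
  let e : EuclideanSpace ℝ (Fin n) ≃ₗᵢ[ℝ] EuclideanSpace ℝ (Fin n) :=
    { toFun := fun x => WithLp.toLp 2 (Uᵀ *ᵥ x.ofLp)
      invFun := fun x => WithLp.toLp 2 (U *ᵥ x.ofLp)
      map_add' := fun x y => by ext; simp [Matrix.mulVec_add]
      map_smul' := fun c x => by ext; simp [Matrix.mulVec_smul]
      left_inv := fun x => by simp [Matrix.mulVec_mulVec, h1]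
      right_inv := fun x => by simp [Matrix.mulVec_mulVec, h2]
      norm_map' := fun x => norm_transpose_mulVec hU x.ofLp }
  have h3 := stdGaussian_map e
  rw [← map_pi_eq_stdGaussian, Measure.map_map e.continuous.measurable (by fun_prop)] at h3
  have h4 := congrArg (Measure.map (WithLp.ofLp : EuclideanSpace ℝ (Fin n) → _)) h3
  rw [Measure.map_map (by fun_prop) (e.continuous.measurable.comp (by fun_prop)),
    Measure.map_map (by fun_prop) (by fun_prop)] at h4
  exact h4.trans Measure.map_id

/-- Independence of the rows makes the centred vector `(X - M) a` a multiple of a standard Gaussian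
vector, whose law does not see the rotation `Uᵀ`. -/
theorem hasLaw_transpose_mulVec_of_gaussianModel {n p : ℕ} {Ω : Type*} [MeasurableSpace Ω]
    {P : Measure Ω} [IsProbabilityMeasure P] {X : Ω → Matrix (Fin n) (Fin p) ℝ}
    {M : Matrix (Fin n) (Fin p) ℝ} {S : Matrix (Fin p) (Fin p) ℝ} (hS : S.PosSemidef)
    (hX : GaussianModel P X M S) {U : Matrix (Fin n) (Fin n) ℝ}
    (hU : U ∈ Matrix.orthogonalGroup (Fin n) ℝ) (a : Fin p → ℝ) :
    HasLaw (fun ω => Uᵀ *ᵥ (X ω *ᵥ a) - Uᵀ *ᵥ (M *ᵥ a))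
      ((Measure.pi fun _ : Fin n => gaussianReal 0 1).map fun z => √(a ⬝ᵥ S *ᵥ a) • z) P := by
  set s := √(a ⬝ᵥ S *ᵥ a) with hs
  have hq : 0 ≤ a ⬝ᵥ S *ᵥ a := by simpa using hS.dotProduct_mulVec_nonneg a
  have hrow : ∀ i, HasLaw (fun ω => X ω i ⬝ᵥ a - M i ⬝ᵥ a)
      (gaussianReal 0 (a ⬝ᵥ S *ᵥ a).toNNReal) P := fun i => by
    have := (hasLaw_inner_multivariateGaussian hS (WithLp.toLp 2 (M i)) a).comp (hX.2 i)
    simpa [Function.comp_def] using gaussianReal_sub_const this (M i ⬝ᵥ a)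
  have hind : iIndepFun (fun (i : Fin n) (ω : Ω) => X ω i ⬝ᵥ a - M i ⬝ᵥ a) P :=
    hX.1.comp (fun i x => x.ofLp ⬝ᵥ a - M i ⬝ᵥ a) fun i => by
      simp only [dotProduct]
      fun_prop
  have hmeas : ∀ i, AEMeasurable (fun ω => X ω i ⬝ᵥ a - M i ⬝ᵥ a) P := fun i =>
    (hrow i).aemeasurable
  have hZ : HasLaw (fun ω i => X ω i ⬝ᵥ a - M i ⬝ᵥ a)
      ((Measure.pi fun _ : Fin n => gaussianReal 0 1).map fun z => s • z) P := by
    refine ⟨by fun_prop, ?_⟩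
    rw [(iIndepFun_iff_map_fun_eq_pi_map hmeas).1 hind]
    have := Measure.pi_map_pi (μ := fun _ : Fin n => gaussianReal 0 1)
      (f := fun _ t => s * t) fun _ => by fun_prop
    refine Eq.trans ?_ this.symm
    congr 1
    ext1 i
    rw [(hrow i).map_eq, gaussianReal_map_const_mul]
    congr 1
    · simp
    · ext
      simp [hs, Real.sq_sqrt hq, hq]
  have hc : HasLaw (fun z => Uᵀ *ᵥ z)
      ((Measure.pi fun _ : Fin n => gaussianReal 0 1).map fun z => s • z)
      ((Measure.pi fun _ : Fin n => gaussianReal 0 1).map fun z => s • z) := by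
    refine ⟨by fun_prop, ?_⟩
    rw [Measure.map_map (by fun_prop) (by fun_prop)]
    conv_rhs => rw [← map_mulVec_pi_gaussianReal hU]
    rw [Measure.map_map (by fun_prop) (by fun_prop)]
    congr 1
    ext z : 1
    simp [Matrix.mulVec_smul]
  have := hc.comp hZ
  convert this using 1
  ext ω : 1
  rw [← Matrix.mulVec_sub]
  rfl

/-! ### Spectrum of the standardized Laplacian and effective dimension -/

namespace Network

variable {n : ℕ}

theorem dotProduct_laplacian_mulVec (A : Network n) (x : Fin n → ℝ) :
    x ⬝ᵥ (Matrix.diagonal A.degree - A.adj) *ᵥ x =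
      (∑ i, ∑ j, A.adj i j * (x i - x j) ^ 2) / 2 := by
  have hsymm : ∀ i j, A.adj i j = A.adj j i := fun i j => A.symm.apply j i
  have h1 : ∑ i, ∑ j, A.adj i j * x j ^ 2 = ∑ i, ∑ j, A.adj i j * x i ^ 2 := by
    rw [Finset.sum_comm]
    exact Finset.sum_congr rfl fun i _ => Finset.sum_congr rfl fun j _ => by rw [hsymm]
  have h2 : ∑ i, ∑ j, A.adj i j * (x i - x j) ^ 2 =
      ∑ i, ∑ j, A.adj i j * x i ^ 2 + ∑ i, ∑ j, A.adj i j * x j ^ 2 -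
        2 * ∑ i, ∑ j, A.adj i j * (x i * x j) := by
    simp only [Finset.mul_sum, ← Finset.sum_add_distrib, ← Finset.sum_sub_distrib]
    exact Finset.sum_congr rfl fun i _ => Finset.sum_congr rfl fun j _ => by ring
  rw [h2, h1, Matrix.sub_mulVec, dotProduct_sub]
  simp only [dotProduct, Matrix.mulVec_diagonal]
  simp only [Matrix.mulVec, dotProduct, degree, Finset.sum_mul, Finset.mul_sum]
  have e1 : ∀ i j, x i * (A.adj i j * x i) = A.adj i j * x i ^ 2 := fun i j => by ring
  have e2 : ∀ i j, x i * (A.adj i j * x j) = A.adj i j * (x i * x j) := fun i j => by ring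
  simp only [e1, e2]
  simp only [← Finset.mul_sum]
  ring

theorem avgDegree_nonneg (A : Network n) : 0 ≤ A.avgDegree :=
  div_nonneg (Finset.sum_nonneg fun i _ => Finset.sum_nonneg fun j _ => A.nonneg i j)
    (Nat.cast_nonneg n)

theorem posSemidef_stdLaplacian (A : Network n) : A.stdLaplacian.PosSemidef := by
  refine Matrix.PosSemidef.of_dotProduct_mulVec_nonneg A.isHermitian_stdLaplacian fun x => ?_
  rw [star_trivial, stdLaplacian, Matrix.smul_mulVec, dotProduct_smul,
    dotProduct_laplacian_mulVec]
  exact mul_nonneg (inv_nonneg.2 A.avgDegree_nonneg) (div_nonneg (Finset.sum_nonneg fun i _ =>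
    Finset.sum_nonneg fun j _ => mul_nonneg (A.nonneg i j) (sq_nonneg _)) zero_le_two)

theorem eig_antitone (A : Network n) : Antitone A.eig := fun _ _ h =>
  A.isHermitian_stdLaplacian.eigenvalues₀_antitone h

theorem eig_nonneg (A : Network n) (i : Fin n) : 0 ≤ A.eig i := by
  have := A.posSemidef_stdLaplacian.eigenvalues_nonneg
    ((Fintype.equivOfCardEq (Fintype.card_fin _)) (Fin.cast (Fintype.card_fin n).symm i))
  simpa [Matrix.IsHermitian.eigenvalues, eig] using this

theorem avgDegree_pos {A : Network n} (hA : A.adj ≠ 0) : 0 < A.avgDegree := by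
  obtain ⟨i, j, hij⟩ : ∃ i j, A.adj i j ≠ 0 := by
    by_contra! h
    exact hA (by ext i j; exact h i j)
  have hn : (0 : ℝ) < n := by exact_mod_cast i.pos
  refine div_pos (Finset.sum_pos' (fun i _ => Finset.sum_nonneg fun j _ => A.nonneg i j)
    ⟨i, Finset.mem_univ i, Finset.sum_pos' (fun j _ => A.nonneg i j)
      ⟨j, Finset.mem_univ j, (A.nonneg i j).lt_of_ne' hij⟩⟩) hn

theorem two_le_of_adj_ne_zero {A : Network n} (hA : A.adj ≠ 0) : 2 ≤ n := by
  by_contra! h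
  refine hA ?_
  ext i j
  have : i = j := Fin.ext (by omega)
  rw [this, A.diag_zero]
  rfl

theorem trace_stdLaplacian {A : Network n} (hA : A.adj ≠ 0) : A.stdLaplacian.trace = n := by
  have h := avgDegree_pos hA
  have hn : (n : ℝ) ≠ 0 := by have := two_le_of_adj_ne_zero hA; positivity
  have h0 : A.adj.trace = 0 := Finset.sum_eq_zero fun i _ => A.diag_zero i
  rw [stdLaplacian, Matrix.trace_smul, Matrix.trace_sub, h0, sub_zero, Matrix.trace_diagonal,
    smul_eq_mul, inv_mul_eq_div, div_eq_iff h.ne', avgDegree]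
  field_simp

theorem stdLaplacian_mulVec_one (A : Network n) : A.stdLaplacian *ᵥ 1 = 0 := by
  have h : (Matrix.diagonal A.degree - A.adj) *ᵥ (1 : Fin n → ℝ) = 0 := by
    ext i
    rw [Matrix.sub_mulVec, Pi.sub_apply, Matrix.mulVec_diagonal]
    simp [Matrix.mulVec, dotProduct, degree]
  rw [stdLaplacian, Matrix.smul_mulVec, h, smul_zero]

variable {A : Network n} {U : Matrix (Fin n) (Fin n) ℝ}

theorem IsEigenbasis.transpose_mul (hU : A.IsEigenbasis U) :
    Uᵀ * A.stdLaplacian = Matrix.diagonal A.eig * Uᵀ := by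
  rw [hU.2, ← Matrix.mul_assoc, ← Matrix.mul_assoc, (Matrix.mem_orthogonalGroup_iff' _ _).1 hU.1, one_mul]

theorem IsEigenbasis.sum_eig (hU : A.IsEigenbasis U) (hA : A.adj ≠ 0) : ∑ i, A.eig i = n := by
  rw [← trace_stdLaplacian hA, hU.2, Matrix.trace_mul_cycle,
    (Matrix.mem_orthogonalGroup_iff' _ _).1 hU.1, one_mul, Matrix.trace_diagonal]

/-- Cohesion says nothing about the last coordinate; this covers it. If the least eigenvalue were
positive, all would be, and the kernel vector `1` would vanish. -/
theorem IsEigenbasis.eig_last (hU : A.IsEigenbasis U) {i : Fin n} (hi : (i : ℕ) + 1 = n) :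
    A.eig i = 0 := by
  by_contra h
  have hpos : 0 < A.eig i := (A.eig_nonneg i).lt_of_ne' h
  have h1 : ∀ k, A.eig k * (Uᵀ *ᵥ 1) k = 0 := fun k => by
    have := congrFun (congrArg (· *ᵥ (1 : Fin n → ℝ)) hU.transpose_mul) k
    simpa only [← Matrix.mulVec_mulVec, stdLaplacian_mulVec_one, Matrix.mulVec_zero,
      Matrix.mulVec_diagonal, Pi.zero_apply, eq_comm] using this
  have h2 : Uᵀ *ᵥ (1 : Fin n → ℝ) = 0 := by
    ext k
    have : 0 < A.eig k := hpos.trans_le (A.eig_antitone (Fin.le_def.2 (by omega)))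
    simpa [this.ne'] using h1 k
  have h3 := dotProduct_transpose_mulVec hU.1 1 1
  rw [h2, zero_dotProduct] at h3
  have h4 : (n : ℝ) = 0 := by simpa using h3.symm
  exact i.pos.ne' (by exact_mod_cast h4)

/-- `sInf ∅ = 0` in `ℕ`, so the minimum must be shown to be attained. The candidate `m = n - 1`
works: the eigenvalues average to `1`, so the largest is at least `1`. -/
theorem IsEigenbasis.effDim_mem (hU : A.IsEigenbasis U) (hA : A.adj ≠ 0) :
    1 ≤ A.effDim ∧ ∃ i : Fin n, (i : ℕ) + 1 + A.effDim = n ∧ 1 / √(A.effDim : ℝ) ≤ A.eig i := by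
  have hn := two_le_of_adj_ne_zero hA
  refine Nat.sInf_mem (s := {m : ℕ | 1 ≤ m ∧ ∃ i : Fin n, (i : ℕ) + 1 + m = n ∧
    1 / √(m : ℝ) ≤ A.eig i}) ⟨n - 1, by omega, ⟨0, by omega⟩, by simp; omega, ?_⟩
  have h1 : (1 : ℝ) ≤ A.eig ⟨0, by omega⟩ := by
    by_contra! h
    have : ∑ i, A.eig i < ∑ _i : Fin n, (1 : ℝ) :=
      Finset.sum_lt_sum_of_nonempty ⟨⟨0, by omega⟩, Finset.mem_univ _⟩ fun i _ =>
        (A.eig_antitone (Fin.le_def.2 (Nat.zero_le _))).trans_lt h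
    rw [hU.sum_eig hA] at this
    simp at this
  refine le_trans ?_ h1
  have : (1 : ℝ) ≤ √((n - 1 : ℕ) : ℝ) := Real.one_le_sqrt.2 (by exact_mod_cast (by omega))
  exact (div_le_one (by linarith)).2 this

theorem IsEigenbasis.le_eig (hU : A.IsEigenbasis U) (hA : A.adj ≠ 0) {i : Fin n}
    (hi : (i : ℕ) + 1 + A.effDim ≤ n) : 1 / √(A.effDim : ℝ) ≤ A.eig i := by
  obtain ⟨k, hk, hle⟩ := (hU.effDim_mem hA).2
  exact hle.trans (A.eig_antitone (Fin.le_def.2 (by omega)))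

/-- A sum over the nodes splits at the effective dimension. -/
theorem IsEigenbasis.sum_le (hU : A.IsEigenbasis U) (hA : A.adj ≠ 0) {f : Fin n → ℝ} {c : ℝ}
    (hc : 0 ≤ c) (hf1 : ∀ i, f i ≤ 1) (hf : ∀ i, 1 / √(A.effDim : ℝ) ≤ A.eig i → f i ≤ c) :
    ∑ i, f i ≤ A.effDim + n * c := by
  obtain ⟨k, hk, -⟩ := (hU.effDim_mem hA).2
  -- With indices from `0`, the `m` smallest eigenvalues sit at `i ≥ n - m`; all earlier ones are at
  -- least `1/√m`.
  calc ∑ i, f i ≤ ∑ i : Fin n, ((if n - A.effDim ≤ (i : ℕ) then 1 else 0) + c) := by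
        refine Finset.sum_le_sum fun i _ => ?_
        split_ifs with h
        · linarith [hf1 i]
        · rw [zero_add]
          exact hf i (hU.le_eig hA (by omega))
    _ = A.effDim + n * c := by
        rw [Finset.sum_add_distrib, Finset.sum_const, Finset.card_univ, Fintype.card_fin,
          nsmul_eq_mul, Fin.sum_univ_eq_sum_range (fun i => if n - A.effDim ≤ i then (1 : ℝ) else 0),
          Finset.sum_ite, Finset.sum_const_zero, add_zero, Finset.sum_const, nsmul_one]
        have : (Finset.range n).filter (n - A.effDim ≤ ·) = Finset.Ico (n - A.effDim) n := by
          ext i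
          simp
          omega
        rw [this, Nat.card_Ico, Nat.sub_sub_self (by omega)]

/-! ### Mean estimation as spectral shrinkage -/

/-- The first-order condition of the mean estimation step. -/
theorem IsMeanEstimate.add_smul_mul_eq {p : ℕ} {α : ℝ} {X Mhat : Matrix (Fin n) (Fin p) ℝ}
    (h : A.IsMeanEstimate α X Mhat) : Mhat + α • (A.stdLaplacian * Mhat) = X := by
  set L := A.stdLaplacian with hLdef
  have hL : Lᵀ = L := by
    simpa [Matrix.IsHermitian, Matrix.conjTranspose_eq_transpose_of_trivial] using
      A.isHermitian_stdLaplacian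
  -- `G` is half the gradient at `Mhat`. Along `Mhat + t G` the objective is quadratic in `t` with
  -- slope `2 tr(Gᵀ G)` at `0`, so minimality forces `G = 0`.
  set G := Mhat + α • (L * Mhat) - X with hG
  set d := (Gᵀ * G).trace + α * (Gᵀ * L * G).trace with hd
  have hexp : ∀ t : ℝ, A.meanObjective α X (Mhat + t • G) =
      A.meanObjective α X Mhat + 2 * t * (Gᵀ * G).trace + t ^ 2 * d := by
    intro t
    have e1 : ((X - Mhat)ᵀ * G).trace = (Gᵀ * (X - Mhat)).trace := by
      rw [← Matrix.trace_transpose, Matrix.transpose_mul, Matrix.transpose_transpose]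
    have e2 : (Mhatᵀ * L * G).trace = (Gᵀ * L * Mhat).trace := by
      rw [← Matrix.trace_transpose, Matrix.transpose_mul, Matrix.transpose_mul,
        Matrix.transpose_transpose, hL, Matrix.mul_assoc]
    have e3 : (Gᵀ * G).trace = α * (Gᵀ * L * Mhat).trace - (Gᵀ * (X - Mhat)).trace := by
      have : Gᵀ * G = α • (Gᵀ * L * Mhat) - Gᵀ * (X - Mhat) := by
        rw [Matrix.mul_assoc, ← Matrix.mul_smul, ← Matrix.mul_sub]
        congr 1
        rw [hG]
        abel
      rw [this, Matrix.trace_sub, Matrix.trace_smul, smul_eq_mul]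
    have e4 : X - (Mhat + t • G) = (X - Mhat) - t • G := by abel
    simp only [meanObjective, ← hLdef]
    rw [e4]
    simp only [Matrix.transpose_sub, Matrix.transpose_add, Matrix.transpose_smul, Matrix.sub_mul,
      Matrix.mul_sub, Matrix.add_mul, Matrix.mul_add, Matrix.smul_mul, Matrix.mul_smul,
      Matrix.trace_sub, Matrix.trace_add, Matrix.trace_smul, smul_eq_mul] at e1 e2 e3 ⊢
    rw [e2, hd]
    linear_combination -(2 * t) * e3 - t * e1
  have hmin : ∀ t : ℝ, 0 ≤ 2 * t * (Gᵀ * G).trace + t ^ 2 * d := fun t => by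
    have := h (Set.mem_univ (Mhat + t • G))
    rw [Set.mem_ofPred_eq, hexp t] at this
    linarith
  have hg0 : 0 ≤ (Gᵀ * G).trace := by
    have := (Matrix.posSemidef_conjTranspose_mul_self G).trace_nonneg
    simpa [Matrix.conjTranspose_eq_transpose_of_trivial] using this
  have hg : (Gᵀ * G).trace = 0 := by
    by_contra hne
    have hpos := hg0.lt_of_ne' hne
    have hD : 0 < |d| + 1 := by positivity
    -- This step makes the change at most `-tr(Gᵀ G)² / (|d| + 1)`; the `+ 1` keeps the denominator
    -- positive.
    have h1 := hmin (-((Gᵀ * G).trace / (|d| + 1)))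
    have h2 : ((Gᵀ * G).trace / (|d| + 1)) ^ 2 * d ≤
        ((Gᵀ * G).trace / (|d| + 1)) ^ 2 * (|d| + 1) := by
      gcongr
      linarith [le_abs_self d]
    have h3 : ((Gᵀ * G).trace / (|d| + 1)) ^ 2 * (|d| + 1) =
        (Gᵀ * G).trace / (|d| + 1) * (Gᵀ * G).trace := by field_simp
    have h4 : 0 < (Gᵀ * G).trace / (|d| + 1) * (Gᵀ * G).trace := by positivity
    nlinarith
  have hG0 : G = 0 := by
    rw [← Matrix.trace_conjTranspose_mul_self_eq_zero_iff,
      Matrix.conjTranspose_eq_transpose_of_trivial, hg]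
  exact sub_eq_zero.1 hG0

/-- The shrinkage factors of the residuals of the mean estimation step. -/
noncomputable def shrinkage (A : Network n) (α : ℝ) (i : Fin n) : ℝ :=
  α * A.eig i / (1 + α * A.eig i)

theorem IsMeanEstimate.transpose_mul_sub {p : ℕ} {α : ℝ} (hα : 0 ≤ α)
    {X Mhat : Matrix (Fin n) (Fin p) ℝ} (h : A.IsMeanEstimate α X Mhat) (hU : A.IsEigenbasis U) :
    Uᵀ * (X - Mhat) = Matrix.diagonal (A.shrinkage α) * (Uᵀ * X) := by
  have h1 : Uᵀ * X = Uᵀ * Mhat + α • (Matrix.diagonal A.eig * (Uᵀ * Mhat)) := by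
    rw [← Matrix.mul_assoc, ← hU.transpose_mul, Matrix.mul_assoc, ← Matrix.mul_smul, ← Matrix.mul_add,
      h.add_smul_mul_eq]
  ext i j
  have h2 := congrFun (congrFun h1 i) j
  have h3 : 0 < 1 + α * A.eig i := by have := mul_nonneg hα (A.eig_nonneg i); linarith
  simp only [Matrix.add_apply, Matrix.smul_apply, Matrix.diagonal_mul, smul_eq_mul] at h2
  rw [Matrix.mul_sub, Matrix.sub_apply, Matrix.diagonal_mul, h2, shrinkage]
  field_simp
  ring

theorem IsMeanEstimate.dotProduct_sampleCov_mulVec {p : ℕ} {α : ℝ} (hα : 0 ≤ α)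
    {X Mhat : Matrix (Fin n) (Fin p) ℝ} (h : A.IsMeanEstimate α X Mhat) (hU : A.IsEigenbasis U)
    (a : Fin p → ℝ) :
    a ⬝ᵥ sampleCov X Mhat *ᵥ a =
      (1 / n) * ∑ i, A.shrinkage α i ^ 2 * (Uᵀ *ᵥ (X *ᵥ a)) i ^ 2 := by
  have h1 : Uᵀ *ᵥ ((X - Mhat) *ᵥ a) = fun i => A.shrinkage α i * (Uᵀ *ᵥ (X *ᵥ a)) i := by
    rw [Matrix.mulVec_mulVec, h.transpose_mul_sub hα hU, ← Matrix.mulVec_mulVec,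
      ← Matrix.mulVec_mulVec]
    ext i
    rw [Matrix.mulVec_diagonal]
  rw [sampleCov, Matrix.smul_mulVec, dotProduct_smul, ← Matrix.mulVec_mulVec,
    Matrix.dotProduct_mulVec, Matrix.vecMul_transpose, ← dotProduct_transpose_mulVec hU.1, h1,
    smul_eq_mul]
  simp only [dotProduct]
  congr 1
  exact Finset.sum_congr rfl fun i _ => by ring

end Network

/-! ### Absorbing error terms into the rate -/

theorem half_le_log_natCast {p : ℕ} (hp : 2 ≤ p) : 1 / 2 ≤ Real.log p := by
  have h1 := Real.log_two_gt_d9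
  have h2 : Real.log 2 ≤ Real.log p := Real.log_le_log (by norm_num) (by exact_mod_cast hp)
  linarith

theorem log_le_log_mul_natCast {n p : ℕ} (hn : 1 ≤ n) (hp : 2 ≤ p) :
    Real.log p ≤ Real.log (p * n) := by
  have : (1 : ℝ) ≤ n := by exact_mod_cast hn
  have : (0 : ℝ) < p := by positivity
  exact Real.log_le_log this (by nlinarith)

section rates

variable {n p m : ℕ} {δ : ℝ}

theorem half_le_sqrt_log_mul (hn : 1 ≤ n) (hp : 2 ≤ p) : 1 / 2 ≤ √(Real.log (p * n)) :=
  Real.le_sqrt_of_sq_le (by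
    linarith [half_le_log_natCast hp, log_le_log_mul_natCast hn hp])

theorem sqrt_log_div_le_covRate : √(Real.log p / n) ≤ covRate n p m δ := by
  simp only [covRate, le_max_iff, le_refl, or_true]

/-- For `p ≥ 2` the logarithmic factors are at least `1/2`, so dropping them costs a factor `2`; the
next two bounds use the same device. -/
theorem effDim_div_le_covRate (hn : 1 ≤ n) (hp : 2 ≤ p) : (m : ℝ) / n ≤ 2 * covRate n p m δ := by
  have h1 : √(Real.log (p * n)) * √(Real.log p) * (m / n) ≤ covRate n p m δ := by
    simp only [covRate, le_max_iff, le_refl, true_or, or_true]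
  have h2 := half_le_log_natCast hp
  have h3 : 1 / 2 ≤ √(Real.log (p * n)) * √(Real.log p) := by
    calc 1 / 2 ≤ √(Real.log p) * √(Real.log p) := by rwa [Real.mul_self_sqrt (by linarith)]
      _ ≤ _ := by
        exact mul_le_mul_of_nonneg_right (Real.sqrt_le_sqrt (log_le_log_mul_natCast hn hp))
          (Real.sqrt_nonneg _)
  have h4 : 1 / 2 * ((m : ℝ) / n) ≤ √(Real.log (p * n)) * √(Real.log p) * (m / n) := by gcongr
  linarith

theorem effDim_mul_rpow_le_covRate (hn : 1 ≤ n) (hp : 2 ≤ p) :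
    (m : ℝ) / ((n : ℝ) ^ ((1 + δ) / 3)) ^ 2 ≤ 2 * covRate n p m δ := by
  have h1 : √(Real.log (p * n)) * m * (n : ℝ) ^ (-(2 + 2 * δ) / 3) ≤ covRate n p m δ := by
    simp only [covRate, le_max_iff, le_refl, true_or]
  have h2 : (n : ℝ) ^ (-(2 + 2 * δ) / 3) = (((n : ℝ) ^ ((1 + δ) / 3)) ^ 2)⁻¹ := by
    rw [← Real.rpow_mul_natCast (by positivity), ← Real.rpow_neg (by positivity)]
    congr 1
    push_cast
    ring
  rw [h2, mul_assoc, ← div_eq_mul_inv] at h1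
  have h3 : 1 / 2 * ((m : ℝ) / ((n : ℝ) ^ ((1 + δ) / 3)) ^ 2) ≤
      √(Real.log (p * n)) * ((m : ℝ) / ((n : ℝ) ^ ((1 + δ) / 3)) ^ 2) := by
    gcongr
    exact half_le_sqrt_log_mul hn hp
  linarith

theorem sqrt_effDim_mul_rpow_le_covRate (hn : 1 ≤ n) (hp : 2 ≤ p) :
    √(m : ℝ) / (n : ℝ) ^ ((1 + δ) / 3) ≤ 2 * covRate n p m δ := by
  have h1 : √(Real.log (p * n)) * √(m : ℝ) * (n : ℝ) ^ (-(1 + δ) / 3) ≤ covRate n p m δ := by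
    simp only [covRate, le_max_iff, le_refl, true_or, or_true]
  have h2 : (n : ℝ) ^ (-(1 + δ) / 3) = ((n : ℝ) ^ ((1 + δ) / 3))⁻¹ := by
    rw [neg_div, Real.rpow_neg (by positivity)]
  rw [h2, mul_assoc, ← div_eq_mul_inv] at h1
  have h3 : 1 / 2 * (√(m : ℝ) / (n : ℝ) ^ ((1 + δ) / 3)) ≤
      √(Real.log (p * n)) * (√(m : ℝ) / (n : ℝ) ^ ((1 + δ) / 3)) := by
    gcongr
    exact half_le_sqrt_log_mul hn hp
  linarith

end rates

/-! ### Spectral sums and cohesion -/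

namespace Network

variable {n : ℕ} {A : Network n} {U : Matrix (Fin n) (Fin n) ℝ} {α : ℝ}

theorem one_le_one_add_mul_eig (hα : 0 ≤ α) (i : Fin n) : 1 ≤ 1 + α * A.eig i := by
  have := mul_nonneg hα (A.eig_nonneg i)
  linarith

theorem shrinkage_nonneg (hα : 0 ≤ α) (i : Fin n) : 0 ≤ A.shrinkage α i :=
  div_nonneg (mul_nonneg hα (A.eig_nonneg i)) (by linarith [one_le_one_add_mul_eig (A := A) hα i])

theorem shrinkage_eq (hα : 0 ≤ α) (i : Fin n) :
    A.shrinkage α i = 1 - (1 + α * A.eig i)⁻¹ := by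
  have := one_le_one_add_mul_eig (A := A) hα i
  have : 1 + α * A.eig i ≠ 0 := by linarith
  rw [shrinkage]
  field_simp
  ring

theorem shrinkage_le_one (hα : 0 ≤ α) (i : Fin n) : A.shrinkage α i ≤ 1 := by
  have := one_le_one_add_mul_eig (A := A) hα i
  have : 0 ≤ (1 + α * A.eig i)⁻¹ := by positivity
  linarith [shrinkage_eq (A := A) hα i]

/-- Where `τ_i ≥ 1/√m`, the summand is at most `√m / α`; the other indices number at most `m` and
contribute at most `1` each. -/
theorem IsEigenbasis.sum_inv_le (hU : A.IsEigenbasis U) (hA : A.adj ≠ 0) (hα : 0 < α) :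
    ∑ i, (1 + α * A.eig i)⁻¹ ≤ A.effDim + n * (√(A.effDim : ℝ) / α) := by
  have hm : (0 : ℝ) < √(A.effDim : ℝ) :=
    Real.sqrt_pos.2 (by exact_mod_cast (hU.effDim_mem hA).1)
  refine hU.sum_le hA (by positivity)
    (fun i => inv_le_one_of_one_le₀ (one_le_one_add_mul_eig hα.le i)) fun i hi => ?_
  have : α * (1 / √(A.effDim : ℝ)) ≤ α * A.eig i := by gcongr
  rw [← inv_div]
  exact inv_anti₀ (by positivity) (by rw [← mul_one_div]; linarith)

theorem IsEigenbasis.sum_inv_sq_le (hU : A.IsEigenbasis U) (hA : A.adj ≠ 0) (hα : 0 < α) :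
    ∑ i, ((1 + α * A.eig i)⁻¹) ^ 2 ≤ A.effDim + n * (A.effDim / α ^ 2) := by
  have hm : (0 : ℝ) < √(A.effDim : ℝ) :=
    Real.sqrt_pos.2 (by exact_mod_cast (hU.effDim_mem hA).1)
  have hi1 : ∀ i, 0 ≤ (1 + α * A.eig i)⁻¹ := fun i =>
    inv_nonneg.2 (by linarith [one_le_one_add_mul_eig (A := A) hα.le i])
  refine hU.sum_le hA (by positivity) (fun i => pow_le_one₀ (hi1 i)
    (inv_le_one_of_one_le₀ (one_le_one_add_mul_eig hα.le i))) fun i hi => ?_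
  have h1 : α * (1 / √(A.effDim : ℝ)) ≤ α * A.eig i := by gcongr
  have h2 : (1 + α * A.eig i)⁻¹ ≤ √(A.effDim : ℝ) / α := by
    rw [← inv_div]
    exact inv_anti₀ (by positivity) (by rw [← mul_one_div]; linarith)
  calc ((1 + α * A.eig i)⁻¹) ^ 2 ≤ (√(A.effDim : ℝ) / α) ^ 2 := pow_le_pow_left₀ (hi1 i) h2 2
    _ = A.effDim / α ^ 2 := by rw [div_pow, Real.sq_sqrt (Nat.cast_nonneg _)]

/-- The powers of `n` in `α`, in the cohesion bound and in `‖v‖ ≤ b √n` cancel exactly, so `α τ_i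
|β_i| ≤ b`. -/
theorem IsCohesive.shrinkage_mul_abs_le (hU : A.IsEigenbasis U) {δ b : ℝ} (hb : 0 ≤ b)
    {v : Fin n → ℝ} (hv : A.IsCohesive U δ v) (hv2 : ‖WithLp.toLp 2 v‖ ^ 2 ≤ b ^ 2 * n)
    (i : Fin n) :
    A.shrinkage ((n : ℝ) ^ ((1 + δ) / 3)) i * |(Uᵀ *ᵥ v) i| ≤
      b * (1 + (n : ℝ) ^ ((1 + δ) / 3) * A.eig i)⁻¹ := by
  have hn : (0 : ℝ) < n := by exact_mod_cast i.pos
  set α := (n : ℝ) ^ ((1 + δ) / 3) with hαdef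
  have hα : 0 < α := by positivity
  have h1 := one_le_one_add_mul_eig (A := A) hα.le i
  have h0 : 0 ≤ (1 + α * A.eig i)⁻¹ := inv_nonneg.2 (by linarith)
  rcases (Nat.succ_le_of_lt i.isLt).lt_or_eq with hi | hi
  · have h2 := hv i hi
    rw [norm_transpose_mulVec hU.1] at h2
    have h3 : ‖WithLp.toLp 2 v‖ ≤ b * (n : ℝ) ^ (1 / 2 : ℝ) := by
      rw [← Real.sqrt_eq_rpow]
      refine abs_le_of_sq_le_sq' ?_ (by positivity) |>.2
      rwa [mul_pow, Real.sq_sqrt hn.le]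
    have h4 : α * (A.eig i * |(Uᵀ *ᵥ v) i|) ≤ b := by
      calc α * (A.eig i * |(Uᵀ *ᵥ v) i|)
          ≤ α * ((n : ℝ) ^ (-(1 + δ) / 3 - 1 / 2) * (b * (n : ℝ) ^ (1 / 2 : ℝ))) := by
            refine mul_le_mul_of_nonneg_left (h2.trans ?_) hα.le
            gcongr
        _ = b * (n : ℝ) ^ ((1 + δ) / 3 + (-(1 + δ) / 3 - 1 / 2) + 1 / 2) := by
            rw [Real.rpow_add hn, Real.rpow_add hn]
            ring
        _ = b := by
            rw [show (1 + δ) / 3 + (-(1 + δ) / 3 - 1 / 2) + 1 / 2 = 0 by ring, Real.rpow_zero,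
              mul_one]
    calc A.shrinkage α i * |(Uᵀ *ᵥ v) i|
        = α * (A.eig i * |(Uᵀ *ᵥ v) i|) * (1 + α * A.eig i)⁻¹ := by
          rw [shrinkage]
          ring
      _ ≤ _ := by gcongr
  · rw [shrinkage, hU.eig_last hi]
    simpa using hb

end Network

/-! ### Concentration in a fixed direction -/

/-- Concentration of the quadratic form of the estimated covariance in a fixed direction. -/
theorem measureReal_dotProduct_sampleCov_le {n p : ℕ} {A : Network n}
    {U : Matrix (Fin n) (Fin n) ℝ} {M : Matrix (Fin n) (Fin p) ℝ}
    {S : Matrix (Fin p) (Fin p) ℝ} {b σ δ : ℝ} (hσ : 0 < σ) (hA : A.adj ≠ 0)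
    (hp : 2 ≤ p) (hpn : Real.log p ≤ n) (hU : A.IsEigenbasis U) (hS : S.PosSemidef)
    {Ω : Type*} [MeasurableSpace Ω] {P : Measure Ω} [IsProbabilityMeasure P]
    {X Mhat : Ω → Matrix (Fin n) (Fin p) ℝ} (hX : GaussianModel P X M S)
    (hMhat : ∀ ω, A.IsMeanEstimate ((n : ℝ) ^ ((1 + δ) / 3)) (X ω) (Mhat ω))
    {a : Fin p → ℝ} (haS : a ⬝ᵥ S *ᵥ a ≤ 4 * σ ^ 2)
    (haM : ∀ i, A.shrinkage ((n : ℝ) ^ ((1 + δ) / 3)) i * |(Uᵀ *ᵥ (M *ᵥ a)) i| ≤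
      2 * b * (1 + (n : ℝ) ^ ((1 + δ) / 3) * A.eig i)⁻¹) :
    P.real {ω | (32 * b ^ 2 + 116 * σ ^ 2) * covRate n p A.effDim δ <
        |a ⬝ᵥ sampleCov (X ω) (Mhat ω) *ᵥ a - a ⬝ᵥ S *ᵥ a|} ≤
      2 * Real.exp (-5 * Real.log p) := by
  have hn2 := Network.two_le_of_adj_ne_zero hA
  have hn : (0 : ℝ) < n := by positivity
  set α := (n : ℝ) ^ ((1 + δ) / 3) with hαdef
  have hα : 0 < α := by positivity
  set q := a ⬝ᵥ S *ᵥ a with hq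
  have hq0 : 0 ≤ q := by simpa using hS.dotProduct_mulVec_nonneg a
  set s := √q with hs
  have hs2 : s ^ 2 = q := Real.sq_sqrt hq0
  set h := A.shrinkage α with hh
  have hh0 : ∀ i, 0 ≤ h i := Network.shrinkage_nonneg hα.le
  have hh1 : ∀ i, h i ≤ 1 := Network.shrinkage_le_one hα.le
  set β := Uᵀ *ᵥ (M *ᵥ a) with hβ
  set m := A.effDim with hm
  set B := 4 * b ^ 2 * (m + n * (m / α ^ 2)) with hBdef
  have hβB : ∑ i, h i ^ 2 * β i ^ 2 ≤ B := by
    calc ∑ i, h i ^ 2 * β i ^ 2 ≤ ∑ i, 4 * b ^ 2 * ((1 + α * A.eig i)⁻¹) ^ 2 := by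
          refine Finset.sum_le_sum fun i _ => ?_
          have := pow_le_pow_left₀ (mul_nonneg (hh0 i) (abs_nonneg _)) (haM i) 2
          rw [mul_pow, sq_abs] at this
          linarith
      _ ≤ B := by
          rw [← Finset.mul_sum]
          exact mul_le_mul_of_nonneg_left (hU.sum_inv_sq_le hA hα) (by positivity)
  have hsum : ∑ i, (1 - h i ^ 2) ≤ 2 * (m + n * (√(m : ℝ) / α)) := by
    calc ∑ i, (1 - h i ^ 2) ≤ ∑ i, 2 * (1 + α * A.eig i)⁻¹ := by
          refine Finset.sum_le_sum fun i _ => ?_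
          have := Network.shrinkage_eq (A := A) hα.le i
          nlinarith [hh0 i, hh1 i]
      _ ≤ _ := by
          rw [← Finset.mul_sum]
          exact mul_le_mul_of_nonneg_left (hU.sum_inv_le hA hα) zero_le_two
  have hsum0 : 0 ≤ ∑ i, (1 - h i ^ 2) := Finset.sum_nonneg fun i _ =>
    sub_nonneg.2 (pow_le_one₀ (hh0 i) (hh1 i))
  have hlaw := hasLaw_transpose_mulVec_of_gaussianModel hS hX hU.1 a
  rw [← hβ, ← hq, ← hs] at hlaw
  set E : Set (Fin n → ℝ) := {g | 21 * (4 * σ ^ 2) * √(n * Real.log p) + B ≤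
    |∑ i, (h i ^ 2 * (g i ^ 2 - q) + 2 * h i ^ 2 * β i * g i)|} with hE
  have hEm : MeasurableSet E := measurableSet_le (by fun_prop) (by fun_prop)
  -- Inclusion in the preimage of the measurable set `E` suffices; the deviation event itself is not
  -- shown to be measurable.
  have hsub : {ω | (32 * b ^ 2 + 116 * σ ^ 2) * covRate n p m δ <
      |a ⬝ᵥ sampleCov (X ω) (Mhat ω) *ᵥ a - q|} ⊆
      {ω | Uᵀ *ᵥ (X ω *ᵥ a) - β ∈ E} := by
    intro ω hω
    rw [Set.mem_ofPred_eq, (hMhat ω).dotProduct_sampleCov_mulVec hα.le hU a] at hω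
    by_contra hE'
    simp only [hE, Set.mem_ofPred_eq, not_le, Pi.sub_apply] at hE'
    set T := ∑ i, (h i ^ 2 * (((Uᵀ *ᵥ (X ω *ᵥ a)) i - β i) ^ 2 - q) +
      2 * h i ^ 2 * β i * ((Uᵀ *ᵥ (X ω *ᵥ a)) i - β i)) with hT
    -- Expand `h²(β + g)²` and write `h² q = q - q(1 - h²)`: bias, fluctuation, target and shrinkage
    -- loss.
    have hdec : ∑ i, h i ^ 2 * (Uᵀ *ᵥ (X ω *ᵥ a)) i ^ 2 =
        ∑ i, h i ^ 2 * β i ^ 2 + T + n * q - q * ∑ i, (1 - h i ^ 2) := by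
      have : (n : ℝ) * q = ∑ _i : Fin n, q := by simp
      rw [this, hT, Finset.mul_sum, ← Finset.sum_add_distrib, ← Finset.sum_add_distrib,
        ← Finset.sum_sub_distrib]
      exact Finset.sum_congr rfl fun i _ => by ring
    have hdev : 1 / n * ∑ i, h i ^ 2 * (Uᵀ *ᵥ (X ω *ᵥ a)) i ^ 2 - q =
        (∑ i, h i ^ 2 * β i ^ 2 + T - q * ∑ i, (1 - h i ^ 2)) / n := by
      rw [hdec]
      field_simp
      ring
    have hβ0 : 0 ≤ ∑ i, h i ^ 2 * β i ^ 2 := Finset.sum_nonneg fun i _ => by positivity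
    have hqs : q * ∑ i, (1 - h i ^ 2) ≤ 4 * σ ^ 2 * (2 * (m + n * (√(m : ℝ) / α))) := by
      gcongr
    have hqs0 : 0 ≤ q * ∑ i, (1 - h i ^ 2) := mul_nonneg hq0 hsum0
    have habs : |∑ i, h i ^ 2 * β i ^ 2 + T - q * ∑ i, (1 - h i ^ 2)| ≤
        2 * B + 84 * σ ^ 2 * √(n * Real.log p) + 8 * σ ^ 2 * (m + n * (√(m : ℝ) / α)) := by
      have hBn : 0 ≤ 4 * σ ^ 2 * (2 * (m + n * (√(m : ℝ) / α))) := by positivity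
      have h84 : 0 ≤ 21 * (4 * σ ^ 2) * √(n * Real.log p) := by positivity
      obtain ⟨hT1, hT2⟩ := abs_lt.1 hE'
      rw [abs_le]
      constructor <;> linarith
    have hrn : √(n * Real.log p) = n * √(Real.log p / n) := by
      have h0 : 0 ≤ Real.log p := by linarith [half_le_log_natCast hp]
      rw [Real.sqrt_eq_iff_eq_sq (by positivity) (by positivity), mul_pow,
        Real.sq_sqrt (by positivity)]
      field_simp
    have hfin : |1 / n * ∑ i, h i ^ 2 * (Uᵀ *ᵥ (X ω *ᵥ a)) i ^ 2 - q| ≤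
        8 * b ^ 2 * (m / n + m / α ^ 2) + 84 * σ ^ 2 * √(Real.log p / n) +
          8 * σ ^ 2 * (m / n + √(m : ℝ) / α) := by
      rw [hdev, abs_div, abs_of_pos hn, div_le_iff₀ hn]
      refine habs.trans (le_of_eq ?_)
      rw [hrn, hBdef]
      field_simp
      ring
    have r1 := effDim_div_le_covRate (n := n) (p := p) (m := m) (δ := δ) (by omega) hp
    have r2 := effDim_mul_rpow_le_covRate (n := n) (p := p) (m := m) (δ := δ) (by omega) hp
    have r3 := sqrt_effDim_mul_rpow_le_covRate (n := n) (p := p) (m := m) (δ := δ) (by omega) hp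
    have r4 := sqrt_log_div_le_covRate (n := n) (p := p) (m := m) (δ := δ)
    rw [← hαdef] at r2 r3
    -- The constant is collected here: `8·4 = 32` for `b²`, and `84 + 8·4 = 116` for `σ²`.
    have hle : 8 * b ^ 2 * (m / n + m / α ^ 2) + 84 * σ ^ 2 * √(Real.log p / n) +
        8 * σ ^ 2 * (m / n + √(m : ℝ) / α) ≤
        8 * b ^ 2 * (2 * covRate n p m δ + 2 * covRate n p m δ) +
          84 * σ ^ 2 * covRate n p m δ +
          8 * σ ^ 2 * (2 * covRate n p m δ + 2 * covRate n p m δ) := by gcongr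
    linarith
  calc _ ≤ P.real {ω | Uᵀ *ᵥ (X ω *ᵥ a) - β ∈ E} := measureReal_mono hsub
    _ = (Measure.pi fun _ : Fin n => gaussianReal 0 1).real {z | s • z ∈ E} := by
        rw [hlaw.measureReal_eq (p := fun g => g ∈ E) hEm]
        exact map_measureReal_apply (by fun_prop) hEm
    _ ≤ _ := by
        refine le_trans (le_of_eq ?_) (gaussian_quadratic_tail (fun i => h i ^ 2) β
          (fun i => sq_nonneg _) (fun i => pow_le_one₀ (hh0 i) (hh1 i)) (s := s)
          (v := 4 * σ ^ 2) (by positivity) (by rwa [hs2]) hβB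
          (by linarith [half_le_log_natCast hp]) hpn)
        congr 1
        ext z
        simp only [hE, Set.mem_ofPred_eq, Pi.smul_apply, smul_eq_mul]
        rw [← hs2, Finset.sum_congr rfl fun i _ => by
          rw [show h i ^ 2 * ((s * z i) ^ 2 - s ^ 2) + 2 * h i ^ 2 * β i * (s * z i) =
            h i ^ 2 * s ^ 2 * (z i ^ 2 - 1) + 2 * h i ^ 2 * β i * s * z i by ring]]

/-! ### From directions to entries -/

section polarization

variable {p : ℕ} (B : Matrix (Fin p) (Fin p) ℝ) (j k : Fin p) (ε : ℝ)

theorem dotProduct_mulVec_single_add_smul_single :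
    (Pi.single j 1 + ε • Pi.single k 1) ⬝ᵥ B *ᵥ (Pi.single j 1 + ε • Pi.single k 1) =
      B j j + ε * (B j k + B k j) + ε ^ 2 * B k k := by
  simp [Matrix.mulVec_add, Matrix.mulVec_smul]
  ring

/-- Parallelogram law: the forms at `e_j ± e_k` sum to `2(B_jj + B_kk)`, and the discarded one is
nonnegative. -/
theorem dotProduct_mulVec_single_add_le (hB : B.PosSemidef) {c : ℝ} (hc : ∀ i, B i i ≤ c)
    (hε : ε ^ 2 = 1) :
    (Pi.single j 1 + ε • Pi.single k 1) ⬝ᵥ B *ᵥ (Pi.single j 1 + ε • Pi.single k 1) ≤ 4 * c := by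
  have h := hB.dotProduct_mulVec_nonneg (Pi.single j 1 + (-ε) • Pi.single k 1)
  rw [star_trivial, dotProduct_mulVec_single_add_smul_single, neg_sq, hε] at h
  rw [dotProduct_mulVec_single_add_smul_single, hε]
  linarith [hc j, hc k]

theorem abs_apply_le_of_polarization (hB : B.IsSymm) {c : ℝ}
    (h : ∀ ε : ℝ, ε = 1 ∨ ε = -1 →
      |(Pi.single j 1 + ε • Pi.single k 1) ⬝ᵥ B *ᵥ (Pi.single j 1 + ε • Pi.single k 1)| ≤ c) :
    |B j k| ≤ c := by
  have h1 := h 1 (Or.inl rfl)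
  have h2 := h (-1) (Or.inr rfl)
  rw [dotProduct_mulVec_single_add_smul_single, hB.apply j k] at h1 h2
  rw [abs_le] at *
  constructor <;> linarith

end polarization

theorem isSymm_sampleCov {n p : ℕ} (X M : Matrix (Fin n) (Fin p) ℝ) : (sampleCov X M).IsSymm := by
  simp [Matrix.IsSymm, sampleCov, Matrix.transpose_mul]

theorem maxNorm_le {p q : ℕ} {B : Matrix (Fin p) (Fin q) ℝ} [Nonempty (Fin p × Fin q)] {c : ℝ}
    (h : ∀ j k, |B j k| ≤ c) : maxNorm B ≤ c :=
  ciSup_le fun jk => h jk.1 jk.2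

theorem one_sub_exp_le_measureReal_maxNorm {n p : ℕ} {A : Network n}
    {U : Matrix (Fin n) (Fin n) ℝ} {M : Matrix (Fin n) (Fin p) ℝ}
    {S : Matrix (Fin p) (Fin p) ℝ} {b σ δ : ℝ} (hb : 0 < b) (hσ : 0 < σ) (hA : A.adj ≠ 0)
    (hp : 2 ≤ p) (hpn : Real.log p ≤ n) (hU : A.IsEigenbasis U) (hM : MeanAssumption A U δ b M)
    (hS : S.PosDef) (hSσ : ∀ j, S j j ≤ σ ^ 2)
    {Ω : Type*} [MeasurableSpace Ω] {P : Measure Ω} [IsProbabilityMeasure P]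
    {X Mhat : Ω → Matrix (Fin n) (Fin p) ℝ} (hX : GaussianModel P X M S)
    (hMhat : ∀ ω, A.IsMeanEstimate ((n : ℝ) ^ ((1 + δ) / 3)) (X ω) (Mhat ω)) :
    1 - Real.exp (-Real.log p) ≤ P.real {ω | maxNorm (sampleCov (X ω) (Mhat ω) - S) ≤
      (32 * b ^ 2 + 116 * σ ^ 2) * covRate n p A.effDim δ} := by
  set c := (32 * b ^ 2 + 116 * σ ^ 2) * covRate n p A.effDim δ with hc
  have hne : Nonempty (Fin p × Fin p) := ⟨⟨⟨0, by omega⟩, ⟨0, by omega⟩⟩⟩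
  have hp0 : (2 : ℝ) ≤ p := by exact_mod_cast hp
  have hSs : S.IsSymm := by
    simpa [Matrix.IsSymm, Matrix.IsHermitian, Matrix.conjTranspose_eq_transpose_of_trivial] using
      hS.isHermitian
  let a : Fin p × Fin p → ℝ → Fin p → ℝ := fun jk ε => Pi.single jk.1 1 + ε • Pi.single jk.2 1
  let E : Fin p × Fin p → ℝ → Set Ω := fun jk ε =>
    {ω | c < |a jk ε ⬝ᵥ sampleCov (X ω) (Mhat ω) *ᵥ a jk ε - a jk ε ⬝ᵥ S *ᵥ a jk ε|}
  have hE : ∀ jk ε, ε = 1 ∨ ε = -1 → P.real (E jk ε) ≤ 2 * Real.exp (-5 * Real.log p) := by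
    intro jk ε hε
    have hε2 : ε ^ 2 = 1 := by rcases hε with rfl | rfl <;> norm_num
    have hεa : |ε| = 1 := by rcases hε with rfl | rfl <;> norm_num
    refine measureReal_dotProduct_sampleCov_le hσ hA hp hpn hU hS.posSemidef hX hMhat
      (dotProduct_mulVec_single_add_le S _ _ ε hS.posSemidef hSσ hε2) fun i => ?_
    have hn : (0 : ℝ) < n := by exact_mod_cast i.pos
    have h1 := (hM jk.1).1.shrinkage_mul_abs_le hU hb.le (hM jk.1).2 i
    have h2 := (hM jk.2).1.shrinkage_mul_abs_le hU hb.le (hM jk.2).2 i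
    have h3 : Uᵀ *ᵥ (M *ᵥ a jk ε) =
        Uᵀ *ᵥ (fun i => M i jk.1) + ε • Uᵀ *ᵥ (fun i => M i jk.2) := by
      simp only [a, Matrix.mulVec_add, Matrix.mulVec_smul, Matrix.mulVec_single_one]
      rfl
    rw [h3, Pi.add_apply, Pi.smul_apply, smul_eq_mul]
    have h4 := abs_add_le ((Uᵀ *ᵥ (fun i => M i jk.1)) i) (ε * (Uᵀ *ᵥ (fun i => M i jk.2)) i)
    rw [abs_mul, hεa, one_mul] at h4
    have h5 := mul_le_mul_of_nonneg_left h4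
      (Network.shrinkage_nonneg (A := A) (α := (n : ℝ) ^ ((1 + δ) / 3)) (by positivity) i)
    linarith
  set good := {ω | maxNorm (sampleCov (X ω) (Mhat ω) - S) ≤ c} with hgood
  -- Covering the whole space and using subadditivity avoids taking the complement of a possibly
  -- non-measurable event.
  have hcover : (Set.univ : Set Ω) ⊆
      good ∪ ⋃ jk ∈ (Finset.univ : Finset (Fin p × Fin p)), (E jk 1 ∪ E jk (-1)) := by
    intro ω _
    by_contra hω
    rw [Set.mem_union, not_or] at hω
    obtain ⟨hω1, hω2⟩ := hω
    simp only [Finset.mem_univ, Set.iUnion_true, Set.mem_iUnion, not_exists, Set.mem_union,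
      not_or] at hω2
    refine hω1 (maxNorm_le fun j k => abs_apply_le_of_polarization _ j k
      ((isSymm_sampleCov _ _).sub hSs) fun ε hε => ?_)
    have : ω ∉ E (j, k) ε := by
      rcases hε with rfl | rfl
      exacts [(hω2 (j, k)).1, (hω2 (j, k)).2]
    rw [Matrix.sub_mulVec, dotProduct_sub]
    exact not_lt.1 this
  have hbad : P.real (⋃ jk ∈ (Finset.univ : Finset (Fin p × Fin p)), (E jk 1 ∪ E jk (-1))) ≤
      Real.exp (-Real.log p) := by
    calc _ ≤ ∑ jk : Fin p × Fin p, P.real (E jk 1 ∪ E jk (-1)) := measureReal_biUnion_finset_le _ _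
      _ ≤ ∑ _jk : Fin p × Fin p, 4 * Real.exp (-5 * Real.log p) :=
          Finset.sum_le_sum fun jk _ => (measureReal_union_le _ _).trans (by
            linarith [hE jk 1 (Or.inl rfl), hE jk (-1) (Or.inr rfl)])
      _ = 4 * (p : ℝ) ^ 2 * Real.exp (-5 * Real.log p) := by
          simp
          ring
      -- The tail `p⁻⁵` beats the `p²` pairs: `4 p² p⁻⁵ ≤ p⁻¹` once `p ≥ 2`.
      _ ≤ Real.exp (-Real.log p) := by
          have h1 : Real.exp (-5 * Real.log p) = ((p : ℝ) ^ 5)⁻¹ := by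
            rw [neg_mul, Real.exp_neg, mul_comm, ← Real.rpow_def_of_pos (by linarith)]
            norm_cast
          rw [h1, Real.exp_neg, Real.exp_log (by linarith)]
          have h2 : 4 * (p : ℝ) ^ 2 * ((p : ℝ) ^ 5)⁻¹ = 4 / (p : ℝ) ^ 2 * (p : ℝ)⁻¹ := by
            field_simp
          rw [h2]
          have h3 : 4 / (p : ℝ) ^ 2 ≤ 1 := (div_le_one (by positivity)).2 (by nlinarith)
          exact mul_le_of_le_one_left (by positivity) h3
  have h1 : (1 : ℝ) ≤ P.real good + P.real (⋃ jk ∈ (Finset.univ : Finset (Fin p × Fin p)),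
      (E jk 1 ∪ E jk (-1))) := by
    exact (probReal_univ (μ := P)).ge.trans ((measureReal_mono hcover).trans (measureReal_union_le _ _))
  linarith

end GNC

theorem mainTheorem8 (b σ : ℝ) (hb : 0 < b) (hσ : 0 < σ) :
    ∃ C : ℝ, 0 < C ∧ ∃ c : ℝ, 0 < c ∧
      ∀ (δ : ℝ), 0 ≤ δ →
      ∀ (p : ℕ → ℕ) (A : ∀ n : ℕ, GNC.Network n),
        (∀ᶠ n in atTop, 1 ≤ p n ∧ (A n).adj ≠ 0) →
        (fun n : ℕ => Real.log (p n)) =o[atTop] (fun n : ℕ => (n : ℝ)) →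
        (fun n : ℕ => ((A n).effDim : ℝ)) =o[atTop] (fun n : ℕ => (n : ℝ)) →
        ∀ᶠ n : ℕ in atTop,
          ∀ (U : Matrix (Fin n) (Fin n) ℝ) (M : Matrix (Fin n) (Fin (p n)) ℝ)
            (S : Matrix (Fin (p n)) (Fin (p n)) ℝ),
            (A n).IsEigenbasis U → GNC.MeanAssumption (A n) U δ b M →
            S.PosDef → (∀ j, S j j ≤ σ ^ 2) →
          ∀ (Ω : Type*) [MeasurableSpace Ω] (P : Measure Ω) [IsProbabilityMeasure P]
            (X Mhat : Ω → Matrix (Fin n) (Fin (p n)) ℝ),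
            GNC.GaussianModel P X M S →
            (∀ ω, (A n).IsMeanEstimate ((n : ℝ) ^ ((1 + δ) / 3)) (X ω) (Mhat ω)) →
            1 - Real.exp (-c * Real.log (p n * ((n : ℝ) - (A n).effDim)))
                - Real.exp (-c * Real.log (p n * (A n).effDim))
                - Real.exp (-c * Real.log (p n))
              ≤ P.real {ω | GNC.maxNorm (GNC.sampleCov (X ω) (Mhat ω) - S) ≤
                  C * GNC.covRate n (p n) (A n).effDim δ} := by
  -- With `c = 1` the third exponential alone covers the failure probability; the first two enter
  -- only through their positivity.
  refine ⟨32 * b ^ 2 + 116 * σ ^ 2, by positivity, 1, one_pos, ?_⟩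
  intro δ _ p A hpA hp _
  filter_upwards [hpA, hp.bound one_pos] with n hn hlog U M S hU hM hS hSσ Ω _ P _ X Mhat hX hMhat
  have h1 := Real.exp_pos (-1 * Real.log (p n * ((n : ℝ) - (A n).effDim)))
  have h2 := Real.exp_pos (-1 * Real.log (p n * (A n).effDim))
  rcases hn.1.lt_or_eq with hp2 | hp1
  · have hpn : Real.log (p n) ≤ n := by
      simpa using (le_abs_self _).trans hlog
    have h := GNC.one_sub_exp_le_measureReal_maxNorm hb hσ hn.2 hp2 hpn hU hM hS hSσ hX hMhat
    rw [← neg_one_mul] at h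
    linarith
  -- For `p = 1` the third exponential equals `1`, so the claimed lower bound is negative.
  · have h3 : Real.exp (-1 * Real.log (p n)) = 1 := by simp [← hp1]
    rw [h3]
    refine le_trans ?_ measureReal_nonneg
    linarith
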